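/- Let $G$ be a finite group and $H\le G$ a subgroup. A $G$-Tambara functor $R$ assigns to each finite $G$-set $X$ a commutative ring $R(X)$ and to each $G$-map $f:X\to Y$ a ring homomorphism $\mathrm{Res}_f:R(Y)\to R(X)$, an additive map $\mathrm{Tr}_f:R(X)\to R(Y)$ and a multiplicative map $\mathrm{Nm}_f:R(X)\to R(Y)$, all functorial, such that finite disjoint unions are sent to products, $\mathrm{Tr}$ and $\mathrm{Nm}$ satisfy base change along pullback squares, and the distributive law $\mathrm{Nm}_f\mathrm{Tr}_p=\mathrm{Tr}_q\mathrm{Nm}_{f'}\mathrm{Res}_e$ holds for every exponential diagram $X\xleftarrow{p}A\xleftarrow{e}X\times_Y\Pi_fA\xrightarrow{f'}\Pi_fA\xrightarrow{q}Y$. For an $H$-Tambara functor $R$, the $G$-Tambara functor $\mathrm{CoInd}_H^GR$ is $X\mapsto R(X|_H)$, where $X|_H$ is the underlying $H$-set of $X$. A Tambara ideal $I$ of a $G$-Tambara functor $R$ is a family of ideals $I(G/K)\subseteq R(G/K)$, $K\le G$, closed under restriction, transfer and norm along all $G$-maps $G/K\to G/L$. Tambara ideals are ordered by levelwise containment; $I\cdot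 J$ is the Tambara ideal generated by all products $ab$ with $a\in I(G/K)$, $b\in J(G/K)$, $K\le G$; and $\mathfrak p$ is prime if it is proper and $I\cdot J\subseteq\mathfrak p$ implies $I\subseteq\mathfrak p$ or $J\subseteq\mathfrak p$. The Nakaoka spectrum $\mathrm{Spec}(R)$ is the set of prime ideals, with the topology generated by the closed sets $V(I)=\{\mathfrak p: I\subseteq\mathfrak p\}$. For a Tambara ideal $I$ of an $H$-Tambara functor $R$, let $(\mathrm{CoInd}_H^GI)(G/K)$ be the ideal of $(\mathrm{CoInd}_H^GR)(G/K)=R((G/K)|_H)$ of all $x$ with $\mathrm{Res}_f(x)\in I(H/L)$ for all $L\le H$ and all $H$-maps $f:H/L\to (G/K)|_H$; under the identification of $R((G/K)|_H)$ with the product of the rings $R(H/L_i)$ over the $H$-orbits $H/L_i$ of $G/K$, this is the product of the ideals $I(H/L_i)$. **Theorem.** For every $H$-Tambara functor $R$: 1. $I\mapsto\mathrm{CoInd}_H^GI$ is a bijection from the set of Tambara ideals of $R$ to the set of Tambara ideals of $\mathrm{CoInd}_H^GR$, which preserves and reflects containment and satisfies $\mathrm{CoInd}_H^G(I\cdot J)=\mathrm{CoInd}_H^GI\cdot\mathrm{CoInd}_H^GJ$.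 A Tambara ideal $\mathfrak p$ of $R$ is prime if and only if $\mathrm{CoInd}_H^G\mathfrak p$ is prime. 2. The inverse of this bijection restricts to a homeomorphism $\mathrm{Spec}(\mathrm{CoInd}_H^GR)\cong\mathrm{Spec}(R)$. It is natural in $R$: for a morphism $\varphi:R\to S$ of $H$-Tambara functors, $\mathfrak q\mapsto\varphi^{-1}\mathfrak q$ and $\mathfrak q\mapsto(\mathrm{CoInd}_H^G\varphi)^{-1}\mathfrak q$ are continuous maps $\mathrm{Spec}(S)\to\mathrm{Spec}(R)$ and $\mathrm{Spec}(\mathrm{CoInd}_H^GS)\to\mathrm{Spec}(\mathrm{CoInd}_H^GR)$, and they commute with the homeomorphisms for $R$ and $S$. -/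

import Mathlib

universe u v

/-- A finite `G`-set. -/
structure FinGSet (G : Type u) [Group G] where
  carrier : Type u
  [action : MulAction G carrier]
  [finite : Finite carrier]

attribute [instance] FinGSet.action FinGSet.finite

namespace FinGSet

instance {G : Type u} [Group G] : CoeSort (FinGSet G) (Type u) := ⟨FinGSet.carrier⟩

/-- The transitive `G`-set `G/K`. -/
def orbit {G : Type u} [Group G] [Finite G] (K : Subgroup G) : FinGSet G where
  carrier := G ⧸ K

/-- A `G`-set regarded as an `H`-set, for a subgroup `H` of `G`. -/
def restrict {G : Type u} [Group G] (H : Subgroup G) (X : FinGSet G) : FinGSet H where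
  carrier := X.carrier

/-- A `G`-map regarded as an `H`-map. -/
def restrictMap {G : Type u} [Group G] (H : Subgroup G) {X Y : FinGSet G} (f : X →[G] Y) :
    restrict H X →[H] restrict H Y where
  toFun := fun x => f x
  map_smul' := fun h x => f.map_smul (h : G) x

section
variable {G : Type u} [Group G]

/-- `Z` is the disjoint union of `X` and `Y` along `i` and `j`. -/
def IsCoproduct {X Y Z : FinGSet G} (i : X →[G] Z) (j : Y →[G] Z) : Prop :=
  Function.Bijective (Sum.elim (fun x => i x) (fun y => j y) : X ⊕ Y → Z)

/-- The square
```
P --q--> Y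
|p       |g
X --f--> Z
```
commutes and is a pullback. -/
def IsPullback {P X Y Z : FinGSet G} (p : P →[G] X) (q : P →[G] Y)
    (f : X →[G] Z) (g : Y →[G] Z) : Prop :=
  (∀ a, f (p a) = g (q a)) ∧ ∀ x y, f x = g y → ∃! a, p a = x ∧ q a = y

/-- The diagram
```
X <--p-- A <--e-- E
|f                |f'
Y <-------q------ P
```
is an exponential diagram: `E` is the pullback of `f` and `q`, and the points of `P` over `y`
correspond, via evaluation `e`, bijectively to the sections of `p` over the fibre `f⁻¹(y)`.
Equivalently, `P` is the dependent product of `A` along `f`. -/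
def IsExponential {X Y A E P : FinGSet G} (f : X →[G] Y) (p : A →[G] X) (e : E →[G] A)
    (f' : E →[G] P) (q : P →[G] Y) : Prop :=
  IsPullback (p.comp e) f' f q ∧
    ∀ (y : Y) (s : {x : X // f x = y} → A), (∀ x, p (s x) = x.1) →
      ∃! π : P, q π = y ∧
        ∀ ε : E, f' ε = π → ∀ h : f (p (e ε)) = y, e ε = s ⟨p (e ε), h⟩

end

end FinGSet

open FinGSet in
/-- A `G`-Tambara functor: a commutative ring `obj X` for each finite `G`-set `X`, with
restrictions, transfers (additive) and norms (multiplicative), such that disjoint unions go to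
products, and transfers and norms satisfy the base change formula and the distributive law. -/
structure TambaraFunctor (G : Type u) [Group G] where
  obj : FinGSet G → Type v
  [ring : ∀ X, CommRing (obj X)]
  res : ∀ {X Y : FinGSet G}, (X →[G] Y) → obj Y →+* obj X
  tr : ∀ {X Y : FinGSet G}, (X →[G] Y) → obj X →+ obj Y
  nm : ∀ {X Y : FinGSet G}, (X →[G] Y) → obj X →* obj Y
  res_id : ∀ (X : FinGSet G) (a : obj X), res (MulActionHom.id G) a = a
  tr_id : ∀ (X : FinGSet G) (a : obj X), tr (MulActionHom.id G) a = a
  nm_id : ∀ (X : FinGSet G) (a : obj X), nm (MulActionHom.id G) a = a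
  res_comp : ∀ {X Y Z : FinGSet G} (g : Y →[G] Z) (f : X →[G] Y) (a : obj Z),
    res (g.comp f) a = res f (res g a)
  tr_comp : ∀ {X Y Z : FinGSet G} (g : Y →[G] Z) (f : X →[G] Y) (a : obj X),
    tr (g.comp f) a = tr g (tr f a)
  nm_comp : ∀ {X Y Z : FinGSet G} (g : Y →[G] Z) (f : X →[G] Y) (a : obj X),
    nm (g.comp f) a = nm g (nm f a)
  subsingleton_obj : ∀ X : FinGSet G, IsEmpty X → Subsingleton (obj X)
  bijective_res : ∀ {X Y Z : FinGSet G} (i : X →[G] Z) (j : Y →[G] Z), IsCoproduct i j →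
    Function.Bijective (fun a : obj Z => (res i a, res j a))
  res_tr : ∀ {P X Y Z : FinGSet G} (p : P →[G] X) (q : P →[G] Y) (f : X →[G] Z) (g : Y →[G] Z),
    IsPullback p q f g → ∀ a : obj X, res g (tr f a) = tr q (res p a)
  res_nm : ∀ {P X Y Z : FinGSet G} (p : P →[G] X) (q : P →[G] Y) (f : X →[G] Z) (g : Y →[G] Z),
    IsPullback p q f g → ∀ a : obj X, res g (nm f a) = nm q (res p a)
  nm_tr : ∀ {X Y A E P : FinGSet G} (f : X →[G] Y) (p : A →[G] X) (e : E →[G] A)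
    (f' : E →[G] P) (q : P →[G] Y),
    IsExponential f p e f' q → ∀ a : obj A, nm f (tr p a) = tr q (nm f' (res e a))

attribute [instance] TambaraFunctor.ring

namespace TambaraFunctor

/-- A morphism of Tambara functors. -/
structure Hom {G : Type u} [Group G] (R S : TambaraFunctor.{u, v} G) where
  app : ∀ X : FinGSet G, R.obj X →+* S.obj X
  app_res : ∀ {X Y : FinGSet G} (f : X →[G] Y) (a : R.obj Y),
    app X (R.res f a) = S.res f (app Y a)
  app_tr : ∀ {X Y : FinGSet G} (f : X →[G] Y) (a : R.obj X),
    app Y (R.tr f a) = S.tr f (app X a)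
  app_nm : ∀ {X Y : FinGSet G} (f : X →[G] Y) (a : R.obj X),
    app Y (R.nm f a) = S.nm f (app X a)

/-- The coinduction of an `H`-Tambara functor: its value at a `G`-set `X` is the value of `R` at
the underlying `H`-set of `X`. -/
def coind {G : Type u} [Group G] (H : Subgroup G) (R : TambaraFunctor.{u, v} H) :
    TambaraFunctor.{u, v} G where
  obj X := R.obj (X.restrict H)
  res f := R.res (FinGSet.restrictMap H f)
  tr f := R.tr (FinGSet.restrictMap H f)
  nm f := R.nm (FinGSet.restrictMap H f)
  res_id X a := R.res_id (X.restrict H) a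
  tr_id X a := R.tr_id (X.restrict H) a
  nm_id X a := R.nm_id (X.restrict H) a
  res_comp g f a := R.res_comp (FinGSet.restrictMap H g) (FinGSet.restrictMap H f) a
  tr_comp g f a := R.tr_comp (FinGSet.restrictMap H g) (FinGSet.restrictMap H f) a
  nm_comp g f a := R.nm_comp (FinGSet.restrictMap H g) (FinGSet.restrictMap H f) a
  subsingleton_obj X hX := R.subsingleton_obj (X.restrict H) hX
  bijective_res i j h := R.bijective_res (FinGSet.restrictMap H i) (FinGSet.restrictMap H j) h
  res_tr p q f g h a := R.res_tr (FinGSet.restrictMap H p) (FinGSet.restrictMap H q)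
    (FinGSet.restrictMap H f) (FinGSet.restrictMap H g) h a
  res_nm p q f g h a := R.res_nm (FinGSet.restrictMap H p) (FinGSet.restrictMap H q)
    (FinGSet.restrictMap H f) (FinGSet.restrictMap H g) h a
  nm_tr f p e f' q h a := R.nm_tr (FinGSet.restrictMap H f) (FinGSet.restrictMap H p)
    (FinGSet.restrictMap H e) (FinGSet.restrictMap H f') (FinGSet.restrictMap H q) h a

/-- Coinduction on morphisms. -/
def Hom.coind {G : Type u} [Group G] (H : Subgroup G) {R S : TambaraFunctor.{u, v} H}
    (φ : Hom R S) : Hom (R.coind H) (S.coind H) where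
  app X := φ.app (X.restrict H)
  app_res f a := φ.app_res (FinGSet.restrictMap H f) a
  app_tr f a := φ.app_tr (FinGSet.restrictMap H f) a
  app_nm f a := φ.app_nm (FinGSet.restrictMap H f) a

end TambaraFunctor

open FinGSet in
/-- A Tambara ideal: an ideal of `R(G/K)` for every subgroup `K`, closed under restriction,
transfer and norm along all maps between the transitive `G`-sets `G/K`. Each such map is a
projection `G/K → G/L` with `K ≤ L` followed by a conjugation isomorphism. -/
@[ext]
structure TambaraIdeal {G : Type u} [Group G] [Finite G] (R : TambaraFunctor.{u, v} G) where
  level : ∀ K : Subgroup G, Ideal (R.obj (orbit K))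
  res_mem : ∀ {K L : Subgroup G} (f : orbit K →[G] orbit L) {a : R.obj (orbit L)},
    a ∈ level L → R.res f a ∈ level K
  tr_mem : ∀ {K L : Subgroup G} (f : orbit K →[G] orbit L) {a : R.obj (orbit K)},
    a ∈ level K → R.tr f a ∈ level L
  nm_mem : ∀ {K L : Subgroup G} (f : orbit K →[G] orbit L) {a : R.obj (orbit K)},
    a ∈ level K → R.nm f a ∈ level L

namespace TambaraIdeal

section
variable {G : Type u} [Group G] [Finite G] {R : TambaraFunctor.{u, v} G}

/-- Containment of Tambara ideals, level by level. -/
instance : PartialOrder (TambaraIdeal R) :=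
  PartialOrder.lift TambaraIdeal.level fun _ _ h => TambaraIdeal.ext h

/-- The intersection of a set of Tambara ideals. -/
instance : InfSet (TambaraIdeal R) where
  sInf S :=
    { level := fun K => ⨅ I ∈ S, I.level K
      res_mem := fun f a ha => by
        simp only [Submodule.mem_iInf] at ha ⊢
        exact fun I hI => I.res_mem f (ha I hI)
      tr_mem := fun f a ha => by
        simp only [Submodule.mem_iInf] at ha ⊢
        exact fun I hI => I.tr_mem f (ha I hI)
      nm_mem := fun f a ha => by
        simp only [Submodule.mem_iInf] at ha ⊢
        exact fun I hI => I.nm_mem f (ha I hI) }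

/-- The Tambara ideal generated by a family of sets of elements. -/
def span (s : ∀ K : Subgroup G, Set (R.obj (FinGSet.orbit K))) : TambaraIdeal R :=
  sInf {I | ∀ K, s K ⊆ I.level K}

/-- The product of Tambara ideals: the Tambara ideal generated by the levelwise products. -/
instance : Mul (TambaraIdeal R) where
  mul I J := span fun K => {c | ∃ a ∈ I.level K, ∃ b ∈ J.level K, c = a * b}

/-- Prime Tambara ideals (in particular, proper). -/
def IsPrime (p : TambaraIdeal R) : Prop :=
  (∃ K, p.level K ≠ ⊤) ∧ ∀ I J : TambaraIdeal R, I * J ≤ p → I ≤ p ∨ J ≤ p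

/-- The contraction of a Tambara ideal along a morphism. -/
def comap {S : TambaraFunctor.{u, v} G} (φ : R.Hom S) (J : TambaraIdeal S) : TambaraIdeal R where
  level K := (J.level K).comap (φ.app (FinGSet.orbit K))
  res_mem f a ha := by
    rw [Ideal.mem_comap] at ha ⊢
    rw [φ.app_res]
    exact J.res_mem f ha
  tr_mem f a ha := by
    rw [Ideal.mem_comap] at ha ⊢
    rw [φ.app_tr]
    exact J.tr_mem f ha
  nm_mem f a ha := by
    rw [Ideal.mem_comap] at ha ⊢
    rw [φ.app_nm]
    exact J.nm_mem f ha

/-- The value of a Tambara ideal at an arbitrary finite `G`-set `X`: the elements of `R(X)` whose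
restriction along every `G/L → X` lies in the ideal. If `X` is a disjoint union of orbits
`G/Lᵢ`, this is the product of the ideals at the `G/Lᵢ` inside `R(X) ≅ ∏ R(G/Lᵢ)`. -/
def value (I : TambaraIdeal R) (X : FinGSet G) : Ideal (R.obj X) :=
  ⨅ (L : Subgroup G) (f : FinGSet.orbit L →[G] X), (I.level L).comap (R.res f)

end

/-- The level `G/K` of the coinduction of a Tambara ideal `I` of an `H`-Tambara functor `R`:
the value of `I` at the underlying `H`-set of `G/K`, as an ideal of the ring
`(R.coind H).obj (G/K) = R.obj ((G/K).restrict H)`. -/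
def coindLevel {G : Type u} [Group G] [Finite G] (H : Subgroup G) {R : TambaraFunctor.{u, v} H}
    (I : TambaraIdeal R) (K : Subgroup G) : Ideal ((R.coind H).obj (FinGSet.orbit K)) :=
  I.value ((FinGSet.orbit K).restrict H)

end TambaraIdeal

/-- The Nakaoka spectrum of a Tambara functor: the set of its prime ideals. -/
def NakaokaSpectrum {G : Type u} [Group G] [Finite G] (R : TambaraFunctor.{u, v} G) :
    Type (max u v) :=
  {p : TambaraIdeal R // p.IsPrime}

namespace NakaokaSpectrum

/-- The underlying Tambara ideal of a point of the Nakaoka spectrum. -/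
def ideal {G : Type u} [Group G] [Finite G] {R : TambaraFunctor.{u, v} G}
    (p : NakaokaSpectrum R) : TambaraIdeal R :=
  p.1

/-- The set `V(I)` of prime ideals that contain `I`. -/
def zeroLocus {G : Type u} [Group G] [Finite G] {R : TambaraFunctor.{u, v} G}
    (I : TambaraIdeal R) : Set (NakaokaSpectrum R) :=
  {p | I ≤ p.ideal}

/-- The topology whose generating closed sets are the sets `V(I)`. -/
instance {G : Type u} [Group G] [Finite G] (R : TambaraFunctor.{u, v} G) :
    TopologicalSpace (NakaokaSpectrum R) :=
  TopologicalSpace.generateFrom {U | ∃ I : TambaraIdeal R, U = (zeroLocus I)ᶜ}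

end NakaokaSpectrum

/-!
Over `H`, the orbit `H/L` is a direct summand of the underlying `H`-set of the induced orbit `G/L`,
so by Frobenius reciprocity a Tambara ideal `J` of `R.coind H` is determined by the restrictions of
its levels `J(G/L)` to the summands `H/L`. These restrictions form a Tambara ideal of `R`: an
`H`-map `H/L → H/M` is the pullback of the induced map `G/L → G/M` along `H/M → G/M`, hence
base change moves its transfer and its norm to `G`. Conversely a Tambara ideal of `R` extends to all
finite `H`-sets orbit by orbit, and is then closed under norms along surjections, such as the
underlying `H`-maps of `G/K → G/L`.

The contraction of a prime ideal is prime because, by the distributive law, the elements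
`Tr_u(c φ(x))` with `x` in `I` already form the Tambara ideal generated by `φ(I)`.
-/

namespace FinGSet

section
variable {G : Type u} [Group G]

/-- A `G`-stable subset of a finite set with a `G`-action, as a finite `G`-set. -/
def ofSubMulAction {X : Type u} [MulAction G X] [Finite X] (S : SubMulAction G X) : FinGSet G where
  carrier := S

/-! ### Disjoint unions and pullbacks -/

theorem IsCoproduct.symm {X Y Z : FinGSet G} {i : X →[G] Z} {j : Y →[G] Z}
    (h : IsCoproduct i j) : IsCoproduct j i := by
  have swap : Sum.elim (fun y => j y) (fun x => i x) =
      Sum.elim (fun x => i x) (fun y => j y) ∘ Sum.swap := by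
    ext (y | x) <;> rfl
  rw [IsCoproduct, swap]
  exact Function.Bijective.comp h (Equiv.sumComm Y X).bijective

theorem IsCoproduct.injective_left {X Y Z : FinGSet G} {i : X →[G] Z} {j : Y →[G] Z}
    (h : IsCoproduct i j) : Function.Injective i :=
  h.injective.comp Sum.inl_injective

theorem IsCoproduct.card_add_card {X Y Z : FinGSet G} {i : X →[G] Z} {j : Y →[G] Z}
    (h : IsCoproduct i j) : Nat.card X + Nat.card Y = Nat.card Z := by
  rw [← Nat.card_sum]
  exact Nat.card_congr (Equiv.ofBijective _ h)

theorem exists_isCoproduct_of_injective {X Z : FinGSet G} {i : X →[G] Z}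
    (hi : Function.Injective i) : ∃ (Y : FinGSet G) (j : Y →[G] Z), IsCoproduct i j := by
  let complement : SubMulAction G Z :=
    { carrier := (Set.range i)ᶜ
      smul_mem' := by
        rintro g z hz ⟨x, hx⟩
        exact hz ⟨g⁻¹ • x, by rw [map_smul, hx, inv_smul_smul]⟩ }
  refine ⟨ofSubMulAction complement, complement.subtype,
    hi.sumElim Subtype.val_injective fun x z hxz => z.2 ⟨x, hxz⟩, fun z => ?_⟩
  by_cases hz : z ∈ Set.range i
  · obtain ⟨x, hx⟩ := hz
    exact ⟨Sum.inl x, hx⟩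
  · exact ⟨Sum.inr ⟨z, hz⟩, rfl⟩

/-- The disjoint union of two finite `G`-sets. -/
def sum (X Y : FinGSet G) : FinGSet G where
  carrier := X ⊕ Y

/-- The left inclusion into a disjoint union. -/
def inl (X Y : FinGSet G) : X →[G] sum X Y where
  toFun := Sum.inl
  map_smul' _ _ := rfl

/-- The right inclusion into a disjoint union. -/
def inr (X Y : FinGSet G) : Y →[G] sum X Y where
  toFun := Sum.inr
  map_smul' _ _ := rfl

/-- The map out of a disjoint union given by a pair of maps. -/
def desc {X Y Z : FinGSet G} (f : X →[G] Z) (g : Y →[G] Z) : sum X Y →[G] Z where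
  toFun := Sum.elim f g
  map_smul' c := Sum.rec (f.map_smul c) (g.map_smul c)

/-- The disjoint union of two maps. -/
def sumMap {X X' Y Y' : FinGSet G} (f : X →[G] Y) (g : X' →[G] Y') : sum X X' →[G] sum Y Y' :=
  desc ((inl Y Y').comp f) ((inr Y Y').comp g)

/-- The fold map, whose transfer is the addition and whose norm is the multiplication. -/
def fold (X : FinGSet G) : sum X X →[G] X :=
  desc (MulActionHom.id G) (MulActionHom.id G)

theorem isCoproduct_sum (X Y : FinGSet G) : IsCoproduct (inl X Y) (inr X Y) := by
  have elim_eq_id : Sum.elim (fun x => inl X Y x) (fun y => inr X Y y) = id :=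
    Sum.elim_inl_inr
  rw [IsCoproduct, elim_eq_id]
  exact Function.bijective_id

theorem IsPullback.flip {P X Y Z : FinGSet G} {p : P →[G] X} {q : P →[G] Y}
    {f : X →[G] Z} {g : Y →[G] Z} (h : IsPullback p q f g) : IsPullback q p g f :=
  ⟨fun a => (h.1 a).symm, fun y x hyx => by
    simpa only [and_comm] using h.2 x y hyx.symm⟩

theorem IsPullback.surjective {P X Y Z : FinGSet G} {p : P →[G] X} {q : P →[G] Y}
    {f : X →[G] Z} {g : Y →[G] Z} (h : IsPullback p q f g) (hf : Function.Surjective f) :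
    Function.Surjective q := fun y => by
  obtain ⟨x, hx⟩ := hf (g y)
  obtain ⟨a, ha, -⟩ := h.2 x y hx
  exact ⟨a, ha.2⟩

theorem isPullback_id_of_injective {X Z : FinGSet G} {i : X →[G] Z} (hi : Function.Injective i) :
    IsPullback (MulActionHom.id G) (MulActionHom.id G) i i :=
  ⟨fun _ => rfl, fun x _ h => ⟨x, ⟨rfl, hi h⟩, fun _ hb => hb.1⟩⟩

/-- The fibre product of two finite `G`-sets over a third. -/
def fiberProd {X Y Z : FinGSet G} (f : X →[G] Z) (g : Y →[G] Z) : FinGSet G :=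
  ofSubMulAction (X := X × Y)
    { carrier := {a | f a.1 = g a.2}
      smul_mem' := fun c a (ha : f a.1 = g a.2) =>
        show f (c • a.1) = g (c • a.2) by rw [map_smul, map_smul, ha] }

/-- The first projection of a fibre product. -/
def fst {X Y Z : FinGSet G} (f : X →[G] Z) (g : Y →[G] Z) : fiberProd f g →[G] X where
  toFun a := a.1.1
  map_smul' _ _ := rfl

/-- The second projection of a fibre product. -/
def snd {X Y Z : FinGSet G} (f : X →[G] Z) (g : Y →[G] Z) : fiberProd f g →[G] Y where
  toFun a := a.1.2
  map_smul' _ _ := rfl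

theorem isPullback_fiberProd {X Y Z : FinGSet G} (f : X →[G] Z) (g : Y →[G] Z) :
    IsPullback (fst f g) (snd f g) f g :=
  ⟨fun a => a.2, fun x y h => ⟨⟨(x, y), h⟩, ⟨rfl, rfl⟩,
    fun _ hb => Subtype.ext (Prod.ext hb.1 hb.2)⟩⟩

theorem IsCoproduct.isEmpty_fiberProd {X Y Z : FinGSet G} {i : X →[G] Z} {j : Y →[G] Z}
    (h : IsCoproduct i j) : IsEmpty (fiberProd i j) :=
  ⟨fun a => Sum.inl_ne_inr (h.injective (a₁ := Sum.inl a.1.1) (a₂ := Sum.inr a.1.2) a.2)⟩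

/-! ### Exponential diagrams -/

open scoped Pointwise in
/-- The dependent product of `p : A → X` along `f : X → Y`. A section of `p` over the fibre of `f`
at `y` is encoded as the pair of `y` and the image of the section. -/
def depProd {X Y A : FinGSet G} (f : X →[G] Y) (p : A →[G] X) : FinGSet G :=
  ofSubMulAction (X := Y × Set A)
    { carrier := {a | Set.BijOn p a.2 (f ⁻¹' {a.1})}
      smul_mem' := by
        rintro c ⟨y, S⟩ ⟨maps, inj, surj⟩
        refine ⟨?_, ?_, fun x hx => ?_⟩
        · rintro _ ⟨b, hb, rfl⟩
          change f (p (c • b)) = c • y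
          rw [map_smul, map_smul, show f (p b) = y from maps hb]
        · rintro _ ⟨b, hb, rfl⟩ _ ⟨b', hb', rfl⟩ h
          change p (c • b) = p (c • b') at h
          rw [map_smul, map_smul] at h
          exact congrArg (c • ·) (inj hb hb' (MulAction.injective c h))
        · obtain ⟨b, hb, hbx⟩ := surj (show f (c⁻¹ • x) = y by
            rw [map_smul, show f x = c • y from hx, inv_smul_smul])
          exact ⟨c • b, Set.smul_mem_smul_set hb, by rw [map_smul, hbx, smul_inv_smul]⟩ }

/-- The structure map of a dependent product. -/
def depProdMap {X Y A : FinGSet G} (f : X →[G] Y) (p : A →[G] X) : depProd f p →[G] Y where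
  toFun a := a.1.1
  map_smul' _ _ := rfl

open scoped Pointwise in
/-- The pairs of a value and a section of `p` over a fibre of `f` that takes this value. -/
def evalDomain {X Y A : FinGSet G} (f : X →[G] Y) (p : A →[G] X) : FinGSet G :=
  ofSubMulAction (X := A × depProd f p)
    { carrier := {a | a.1 ∈ a.2.1.2}
      smul_mem' := fun _ a (ha : a.1 ∈ a.2.1.2) => Set.smul_mem_smul_set ha }

/-- The evaluation of sections. -/
def eval {X Y A : FinGSet G} (f : X →[G] Y) (p : A →[G] X) : evalDomain f p →[G] A where
  toFun a := a.1.1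
  map_smul' _ _ := rfl

/-- The projection of the domain of the evaluation to the dependent product. -/
def evalProj {X Y A : FinGSet G} (f : X →[G] Y) (p : A →[G] X) :
    evalDomain f p →[G] depProd f p where
  toFun a := a.1.2
  map_smul' _ _ := rfl

theorem isPullback_eval {X Y A : FinGSet G} (f : X →[G] Y) (p : A →[G] X) :
    IsPullback (p.comp (eval f p)) (evalProj f p) f (depProdMap f p) := by
  refine ⟨fun a => a.1.2.2.mapsTo a.2, fun x π h => ?_⟩
  obtain ⟨b, hb, hbx⟩ := π.2.surjOn h
  refine ⟨⟨(b, π), hb⟩, ⟨hbx, rfl⟩, ?_⟩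
  rintro ⟨⟨b', π'⟩, hb'⟩ ⟨hbx', rfl⟩
  exact Subtype.ext (Prod.ext (π'.2.injOn hb' hb (hbx'.trans hbx.symm)) rfl)

theorem bijOn_range_section {X Y A : FinGSet G} {f : X →[G] Y} {p : A →[G] X} {y : Y}
    {s : {x : X // f x = y} → A} (hs : ∀ x, p (s x) = x.1) :
    Set.BijOn p (Set.range s) (f ⁻¹' {y}) := by
  refine ⟨?_, ?_, fun x hx => ⟨s ⟨x, hx⟩, ⟨_, rfl⟩, hs _⟩⟩
  · rintro _ ⟨x, rfl⟩
    exact (congrArg f (hs x)).trans x.2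
  · rintro _ ⟨x, rfl⟩ _ ⟨x', rfl⟩ h
    exact congrArg s (Subtype.ext ((hs x).symm.trans (h.trans (hs x'))))

theorem isExponential_depProd {X Y A : FinGSet G} (f : X →[G] Y) (p : A →[G] X) :
    IsExponential f p (eval f p) (evalProj f p) (depProdMap f p) := by
  refine ⟨isPullback_eval f p, fun y s hs =>
    ⟨⟨(y, Set.range s), bijOn_range_section hs⟩, ⟨rfl, ?_⟩, ?_⟩⟩
  · rintro ⟨⟨b, _⟩, hb⟩ rfl h
    obtain ⟨x, rfl⟩ : ∃ x, s x = b := hb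
    exact congrArg s (Subtype.ext (hs x).symm)
  · rintro ⟨⟨_, S⟩, hS⟩ ⟨rfl, hs'⟩
    have eq_section : ∀ b (hb : b ∈ S), b = s ⟨p b, hS.mapsTo hb⟩ :=
      fun b hb => hs' ⟨(b, ⟨(_, S), hS⟩), hb⟩ rfl (hS.mapsTo hb)
    refine Subtype.ext (Prod.ext rfl (Set.Subset.antisymm ?_ ?_))
    · exact fun b hb => ⟨_, (eq_section b hb).symm⟩
    · rintro _ ⟨⟨_, hx⟩, rfl⟩
      obtain ⟨b, hb, rfl⟩ := hS.surjOn hx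
      exact (eq_section b hb) ▸ hb

theorem isExponential_fold {X Y : FinGSet G} (f : X →[G] Y) :
    IsExponential (fold Y) (sumMap f (MulActionHom.id G)) (sumMap (MulActionHom.id G) f)
      (fold X) f := by
  refine ⟨⟨by rintro (x | x) <;> rfl, ?_⟩, fun y s hs => ?_⟩
  · rintro (_ | _) x rfl
    · refine ⟨Sum.inl x, ⟨rfl, rfl⟩, ?_⟩
      rintro (x' | x') ⟨h, hx'⟩
      · exact congrArg Sum.inl hx'
      · cases h
    · refine ⟨Sum.inr x, ⟨rfl, rfl⟩, ?_⟩
      rintro (x' | x') ⟨h, hx'⟩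
      · cases h
      · exact congrArg Sum.inr hx'
  · obtain ⟨x, hsx, rfl⟩ : ∃ x, s ⟨Sum.inl y, rfl⟩ = Sum.inl x ∧ f x = y := by
      have hs_inl := hs ⟨Sum.inl y, rfl⟩
      rcases hsx : s ⟨Sum.inl y, rfl⟩ with x | y' <;> rw [hsx] at hs_inl
      · exact ⟨x, rfl, Sum.inl_injective hs_inl⟩
      · cases hs_inl
    have hsy : s ⟨Sum.inr (f x), rfl⟩ = Sum.inr (f x) := by
      have hs_inr := hs ⟨Sum.inr (f x), rfl⟩
      rcases hsy : s ⟨Sum.inr (f x), rfl⟩ with x' | y' <;> rw [hsy] at hs_inr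
      · cases hs_inr
      · exact congrArg Sum.inr (Sum.inr_injective hs_inr)
    refine ⟨x, ⟨rfl, ?_⟩, fun z ⟨hz, hsz⟩ => ?_⟩
    · rintro (_ | _) rfl -
      · exact hsx.symm
      · exact hsy.symm
    · have hs_eq : s ⟨Sum.inl (f z), hz⟩ = s ⟨Sum.inl (f x), rfl⟩ :=
        congrArg s (Subtype.ext (congrArg Sum.inl hz))
      exact Sum.inl_injective ((hsz (Sum.inl z) rfl hz).trans (hs_eq.trans hsx))

/-! ### Orbits -/

theorem surjective_of_isPretransitive {X Y : FinGSet G} [Nonempty X]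
    [MulAction.IsPretransitive G Y] (f : X →[G] Y) : Function.Surjective f := by
  intro y
  obtain ⟨x⟩ := ‹Nonempty X›
  obtain ⟨g, hg⟩ := MulAction.exists_smul_eq G (f x) y
  exact ⟨g • x, by rw [map_smul, hg]⟩

variable [Finite G]

instance (K : Subgroup G) : MulAction.IsPretransitive G (orbit K) :=
  inferInstanceAs (MulAction.IsPretransitive G (G ⧸ K))

/-- The coset of `1` in `G/K`. -/
def base (K : Subgroup G) : orbit K :=
  ((1 : G) : G ⧸ K)

instance (K : Subgroup G) : Nonempty (orbit K) :=
  ⟨base K⟩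

theorem exists_smul_base_eq {K : Subgroup G} (a : orbit K) : ∃ g : G, g • base K = a :=
  MulAction.exists_smul_eq G (base K) a

theorem stabilizer_base (K : Subgroup G) : MulAction.stabilizer G (base K) = K :=
  MulAction.stabilizer_quotient K

theorem smul_base_eq_smul_base {K : Subgroup G} {g g' : G} :
    g • base K = g' • base K ↔ g⁻¹ * g' ∈ K := by
  conv_rhs => rw [← stabilizer_base K, MulAction.mem_stabilizer_iff, mul_smul, inv_smul_eq_iff]
  exact eq_comm

theorem orbitHom_ext {X : FinGSet G} {K : Subgroup G} {f g : orbit K →[G] X}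
    (h : f (base K) = g (base K)) : f = g := by
  ext a
  obtain ⟨c, rfl⟩ := exists_smul_base_eq a
  rw [map_smul, map_smul, h]

/-- The `G`-map `G/K → X` that sends the coset of `1` to `x`. -/
def orbitMap {X : FinGSet G} {K : Subgroup G} (x : X) (h : K ≤ MulAction.stabilizer G x) :
    orbit K →[G] X where
  toFun a := MulAction.ofQuotientStabilizer G x (Subgroup.quotientMapOfLE h a)
  map_smul' g a := by
    induction a using QuotientGroup.induction_on with
    | H a => exact mul_smul g a x

theorem orbitMap_base {X : FinGSet G} {K : Subgroup G} (x : X)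
    (h : K ≤ MulAction.stabilizer G x) : orbitMap x h (base K) = x :=
  one_smul G x

theorem orbitMap_stabilizer_injective {X : FinGSet G} (x : X) :
    Function.Injective (orbitMap x (le_refl (MulAction.stabilizer G x))) := by
  intro a b hab
  obtain ⟨g, rfl⟩ := exists_smul_base_eq a
  obtain ⟨g', rfl⟩ := exists_smul_base_eq b
  rw [map_smul, map_smul, orbitMap_base] at hab
  rw [smul_base_eq_smul_base, MulAction.mem_stabilizer_iff, mul_smul, ← hab, inv_smul_smul]

theorem exists_isCoproduct_orbit (X : FinGSet G) [Nonempty X] :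
    ∃ (K : Subgroup G) (Y : FinGSet G) (i : orbit K →[G] X) (j : Y →[G] X), IsCoproduct i j := by
  obtain ⟨x⟩ := ‹Nonempty X›
  obtain ⟨Y, j, h⟩ := exists_isCoproduct_of_injective (orbitMap_stabilizer_injective x)
  exact ⟨_, Y, _, j, h⟩

theorem orbit_induction {motive : FinGSet G → Prop}
    (isEmpty : ∀ X : FinGSet G, IsEmpty X → motive X)
    (isCoproduct : ∀ {K : Subgroup G} {Y Z : FinGSet G} (i : orbit K →[G] Z) (j : Y →[G] Z),
      IsCoproduct i j → motive Y → motive Z)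
    (X : FinGSet G) : motive X := by
  induction hn : Nat.card X using Nat.strong_induction_on generalizing X with
  | _ n ih =>
  rcases isEmpty_or_nonempty X with hX | hX
  · exact isEmpty X hX
  · obtain ⟨K, Y, i, j, h⟩ := exists_isCoproduct_orbit X
    have card_pos : 0 < Nat.card (orbit K) := Nat.card_pos
    have card_add := h.card_add_card
    exact isCoproduct i j h (ih (Nat.card Y) (by omega) Y rfl)

end

/-! ### Induced orbits -/

section
variable {G : Type u} [Group G] [Finite G] (H : Subgroup G)

/-- The inclusion of `H/L` into the underlying `H`-set of `G/L`: the unit of the adjunction between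
induction and restriction, as `G/L` is the `G`-set induced by `H/L`. -/
def indUnit (L : Subgroup H) : orbit L →[H] (orbit (L.map H.subtype)).restrict H :=
  orbitMap (X := (orbit (L.map H.subtype)).restrict H) (base (L.map H.subtype)) fun h hh => by
    have mem_stabilizer : (h : G) ∈ MulAction.stabilizer G (base (L.map H.subtype)) := by
      rw [stabilizer_base]
      exact ⟨h, hh, rfl⟩
    exact mem_stabilizer

variable {H}

theorem indUnit_base (L : Subgroup H) : indUnit H L (base L) = base (L.map H.subtype) :=
  orbitMap_base _ _

theorem indUnit_smul_base (L : Subgroup H) (h : H) :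
    indUnit H L (h • base L) = (h : G) • base (L.map H.subtype) :=
  ((indUnit H L).map_smul h (base L)).trans (congrArg (h • ·) (indUnit_base L))

theorem indUnit_injective (L : Subgroup H) : Function.Injective (indUnit H L) := by
  intro a b hab
  obtain ⟨h, rfl⟩ := exists_smul_base_eq a
  obtain ⟨h', rfl⟩ := exists_smul_base_eq b
  rw [indUnit_smul_base, indUnit_smul_base] at hab
  obtain ⟨c, hc, hch⟩ := smul_base_eq_smul_base.mp hab
  obtain rfl : c = h⁻¹ * h' := Subtype.ext hch
  exact smul_base_eq_smul_base.mpr hc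

/-- The `G`-map `G/L → X` adjoint to an `H`-map `H/L → X`. -/
def indLift {X : FinGSet G} {L : Subgroup H} (f : orbit L →[H] X.restrict H) :
    orbit (L.map H.subtype) →[G] X :=
  orbitMap (f (base L) : X) fun g hg => by
    obtain ⟨h, hh, rfl⟩ := hg
    rw [← stabilizer_base L] at hh
    exact (f.map_smul h (base L)).symm.trans (congrArg f hh)

theorem indLift_comp_indUnit {X : FinGSet G} {L : Subgroup H} (f : orbit L →[H] X.restrict H) :
    (restrictMap H (indLift f)).comp (indUnit H L) = f :=
  orbitHom_ext ((congrArg (indLift f) (indUnit_base L)).trans (orbitMap_base _ _))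

/-- The `G`-map `G/L → G/M` induced by an `H`-map `H/L → H/M`. -/
def indMap {L M : Subgroup H} (f : orbit L →[H] orbit M) :
    orbit (L.map H.subtype) →[G] orbit (M.map H.subtype) :=
  indLift ((indUnit H M).comp f)

theorem indMap_comp_indUnit {L M : Subgroup H} (f : orbit L →[H] orbit M) :
    (restrictMap H (indMap f)).comp (indUnit H L) = (indUnit H M).comp f :=
  indLift_comp_indUnit _

theorem mem_range_indUnit_of_indMap {L M : Subgroup H} (f : orbit L →[H] orbit M)
    {x : orbit (L.map H.subtype)} (hx : indMap f x ∈ Set.range (indUnit H M)) :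
    x ∈ Set.range (indUnit H L) := by
  obtain ⟨y, hy⟩ := hx
  obtain ⟨g, rfl⟩ := exists_smul_base_eq x
  obtain ⟨h, rfl⟩ := exists_smul_base_eq y
  obtain ⟨k, hk⟩ := exists_smul_base_eq (f (base L))
  have indMap_base : indMap f (base (L.map H.subtype)) = (k : G) • base (M.map H.subtype) :=
    (orbitMap_base _ _).trans ((congrArg (indUnit H M) hk.symm).trans (indUnit_smul_base M k))
  have hgk : (g * k)⁻¹ * h ∈ M.map H.subtype := by
    rw [← smul_base_eq_smul_base, mul_smul, ← indMap_base, ← map_smul]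
    exact hy.symm.trans (indUnit_smul_base M h)
  have hg : g ∈ H := by
    have hgkh := Subgroup.map_subtype_le M hgk
    rwa [Subgroup.mul_mem_cancel_right H h.2, inv_mem_iff, Subgroup.mul_mem_cancel_right H k.2]
      at hgkh
  exact ⟨(⟨g, hg⟩ : H) • base L, indUnit_smul_base L ⟨g, hg⟩⟩

theorem isPullback_indMap {L M : Subgroup H} (f : orbit L →[H] orbit M) :
    IsPullback (indUnit H L) f (restrictMap H (indMap f)) (indUnit H M) := by
  have comm : ∀ a, restrictMap H (indMap f) (indUnit H L a) = indUnit H M (f a) :=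
    DFunLike.congr_fun (indMap_comp_indUnit f)
  refine ⟨comm, fun x y hxy => ?_⟩
  obtain ⟨a, rfl⟩ := mem_range_indUnit_of_indMap f ⟨y, hxy.symm⟩
  exact ⟨a, ⟨rfl, indUnit_injective M ((comm a).symm.trans hxy)⟩,
    fun b hb => indUnit_injective L hb.1⟩

end

end FinGSet

namespace TambaraFunctor

open FinGSet

section
variable {G : Type u} [Group G] (R : TambaraFunctor.{u, v} G)

theorem res_tr_of_injective {X Z : FinGSet G} {i : X →[G] Z} (hi : Function.Injective i)
    (a : R.obj X) : R.res i (R.tr i a) = a := by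
  rw [R.res_tr _ _ _ _ (isPullback_id_of_injective hi), R.res_id, R.tr_id]

theorem res_nm_of_injective {X Z : FinGSet G} {i : X →[G] Z} (hi : Function.Injective i)
    (a : R.obj X) : R.res i (R.nm i a) = a := by
  rw [R.res_nm _ _ _ _ (isPullback_id_of_injective hi), R.res_id, R.nm_id]

theorem res_tr_eq_zero {X Y Z : FinGSet G} {i : X →[G] Z} {j : Y →[G] Z}
    (h : IsCoproduct i j) (a : R.obj X) : R.res j (R.tr i a) = 0 := by
  have := R.subsingleton_obj _ h.isEmpty_fiberProd
  rw [R.res_tr _ _ _ _ (isPullback_fiberProd i j),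
    Subsingleton.elim (R.res (fst i j) a) 0, map_zero]

theorem res_nm_eq_one {X Y Z : FinGSet G} {i : X →[G] Z} {j : Y →[G] Z}
    (h : IsCoproduct i j) (a : R.obj X) : R.res j (R.nm i a) = 1 := by
  have := R.subsingleton_obj _ h.isEmpty_fiberProd
  rw [R.res_nm _ _ _ _ (isPullback_fiberProd i j),
    Subsingleton.elim (R.res (fst i j) a) 1, map_one]

theorem eq_of_res_eq {X Y Z : FinGSet G} {i : X →[G] Z} {j : Y →[G] Z}
    (h : IsCoproduct i j) {a b : R.obj Z} (hi : R.res i a = R.res i b)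
    (hj : R.res j a = R.res j b) : a = b :=
  (R.bijective_res i j h).injective (Prod.ext hi hj)

theorem tr_res_add_tr_res {X Y Z : FinGSet G} {i : X →[G] Z} {j : Y →[G] Z}
    (h : IsCoproduct i j) (a : R.obj Z) :
    R.tr i (R.res i a) + R.tr j (R.res j a) = a := by
  apply R.eq_of_res_eq h
  · rw [map_add, R.res_tr_of_injective h.injective_left, R.res_tr_eq_zero h.symm, add_zero]
  · rw [map_add, R.res_tr_of_injective h.symm.injective_left, R.res_tr_eq_zero h, zero_add]

theorem nm_res_mul_nm_res {X Y Z : FinGSet G} {i : X →[G] Z} {j : Y →[G] Z}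
    (h : IsCoproduct i j) (a : R.obj Z) :
    R.nm i (R.res i a) * R.nm j (R.res j a) = a := by
  apply R.eq_of_res_eq h
  · rw [map_mul, R.res_nm_of_injective h.injective_left, R.res_nm_eq_one h.symm, mul_one]
  · rw [map_mul, R.res_nm_of_injective h.symm.injective_left, R.res_nm_eq_one h, one_mul]

/-- The element of `R(X ⊔ Y)` with given components in `R(X)` and `R(Y)`. -/
def pair {X Y : FinGSet G} (a : R.obj X) (b : R.obj Y) : R.obj (sum X Y) :=
  R.tr (inl X Y) a + R.tr (inr X Y) b

theorem res_inl_pair {X Y : FinGSet G} (a : R.obj X) (b : R.obj Y) :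
    R.res (inl X Y) (R.pair a b) = a := by
  rw [pair, map_add, R.res_tr_of_injective (isCoproduct_sum X Y).injective_left,
    R.res_tr_eq_zero (isCoproduct_sum X Y).symm, add_zero]

theorem res_inr_pair {X Y : FinGSet G} (a : R.obj X) (b : R.obj Y) :
    R.res (inr X Y) (R.pair a b) = b := by
  rw [pair, map_add, R.res_tr_of_injective (isCoproduct_sum X Y).symm.injective_left,
    R.res_tr_eq_zero (isCoproduct_sum X Y), zero_add]

theorem eq_pair {X Y : FinGSet G} {a : R.obj X} {b : R.obj Y} {c : R.obj (sum X Y)}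
    (ha : R.res (inl X Y) c = a) (hb : R.res (inr X Y) c = b) : c = R.pair a b :=
  R.eq_of_res_eq (isCoproduct_sum X Y) (ha.trans (R.res_inl_pair a b).symm)
    (hb.trans (R.res_inr_pair a b).symm)

theorem pair_mul_pair {X Y : FinGSet G} (a a' : R.obj X) (b b' : R.obj Y) :
    R.pair a b * R.pair a' b' = R.pair (a * a') (b * b') :=
  R.eq_pair (by rw [map_mul, res_inl_pair, res_inl_pair])
    (by rw [map_mul, res_inr_pair, res_inr_pair])

theorem tr_desc_pair {X Y Z : FinGSet G} (f : X →[G] Z) (g : Y →[G] Z) (a : R.obj X)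
    (b : R.obj Y) : R.tr (desc f g) (R.pair a b) = R.tr f a + R.tr g b := by
  rw [pair, map_add, ← R.tr_comp, ← R.tr_comp]
  rfl

theorem nm_desc_pair {X Y Z : FinGSet G} (f : X →[G] Z) (g : Y →[G] Z) (a : R.obj X)
    (b : R.obj Y) : R.nm (desc f g) (R.pair a b) = R.nm f a * R.nm g b := by
  rw [← R.nm_res_mul_nm_res (isCoproduct_sum X Y) (R.pair a b), res_inl_pair, res_inr_pair,
    map_mul, ← R.nm_comp, ← R.nm_comp]
  rfl

theorem nm_fold_pair {X : FinGSet G} (a b : R.obj X) : R.nm (fold X) (R.pair a b) = a * b := by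
  rw [fold, nm_desc_pair, R.nm_id, R.nm_id]

theorem tr_sumMap_pair {X X' Y Y' : FinGSet G} (f : X →[G] Y) (g : X' →[G] Y') (a : R.obj X)
    (b : R.obj X') : R.tr (sumMap f g) (R.pair a b) = R.pair (R.tr f a) (R.tr g b) := by
  rw [sumMap, tr_desc_pair, R.tr_comp, R.tr_comp, pair]

theorem res_sumMap_pair {X X' Y Y' : FinGSet G} (f : X →[G] Y) (g : X' →[G] Y') (a : R.obj Y)
    (b : R.obj Y') : R.res (sumMap f g) (R.pair a b) = R.pair (R.res f a) (R.res g b) := by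
  apply R.eq_pair
  · rw [← R.res_comp, ← R.res_inl_pair a b, ← R.res_comp, res_inl_pair]
    rfl
  · rw [← R.res_comp, ← R.res_inr_pair a b, ← R.res_comp, res_inr_pair]
    rfl

/-- Frobenius reciprocity is the distributive law for the fold map. -/
theorem tr_mul_res {X Y : FinGSet G} (f : X →[G] Y) (a : R.obj X) (b : R.obj Y) :
    R.tr f (a * R.res f b) = R.tr f a * b :=
  calc R.tr f (a * R.res f b)
      = R.tr f (R.nm (fold X) (R.res (sumMap (MulActionHom.id G) f) (R.pair a b))) := by
        rw [res_sumMap_pair, nm_fold_pair, R.res_id]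
    _ = R.nm (fold Y) (R.tr (sumMap f (MulActionHom.id G)) (R.pair a b)) :=
        (R.nm_tr _ _ _ _ _ (isExponential_fold f) _).symm
    _ = R.tr f a * b := by
        rw [tr_sumMap_pair, nm_fold_pair, R.tr_id]

theorem tr_mul_tr {X Y Z : FinGSet G} (f : X →[G] Z) (g : Y →[G] Z) (a : R.obj X)
    (b : R.obj Y) : R.tr f a * R.tr g b =
      R.tr (f.comp (fst f g)) (R.res (fst f g) a * R.res (snd f g) b) := by
  rw [← R.tr_mul_res, R.res_tr _ _ _ _ (isPullback_fiberProd f g).flip, mul_comm a,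
    ← R.tr_mul_res, ← R.tr_comp, mul_comm]

theorem mem_of_forall_tr_res_mem [Finite G] {X : FinGSet G} (S : AddSubmonoid (R.obj X))
    {a : R.obj X} (h : ∀ (L : Subgroup G) (f : orbit L →[G] X), R.tr f (R.res f a) ∈ S) :
    a ∈ S := by
  induction X using orbit_induction with
  | isEmpty X hX =>
    have := R.subsingleton_obj X hX
    rw [Subsingleton.elim a 0]
    exact S.zero_mem
  | isCoproduct i j hij ih =>
    rw [← R.tr_res_add_tr_res hij a]
    refine S.add_mem (h _ i) (ih (S.comap (R.tr j)) fun L f => ?_)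
    rw [AddSubmonoid.mem_comap, ← R.res_comp, ← R.tr_comp]
    exact h L (j.comp f)

theorem Hom.app_pair {R S : TambaraFunctor.{u, v} G} (φ : R.Hom S) {X Y : FinGSet G}
    (a : R.obj X) (b : R.obj Y) : φ.app _ (R.pair a b) = S.pair (φ.app X a) (φ.app Y b) := by
  rw [pair, map_add, φ.app_tr, φ.app_tr, pair]

end

theorem tr_res_indUnit {G : Type u} [Group G] [Finite G] {H : Subgroup G}
    (R : TambaraFunctor.{u, v} H) {X : FinGSet G} {L : Subgroup H}
    (f : orbit L →[H] X.restrict H) (b : R.obj ((orbit (L.map H.subtype)).restrict H)) :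
    R.tr f (R.res (indUnit H L) b) =
      R.tr (restrictMap H (indLift f)) (R.tr (indUnit H L) 1 * b) := by
  rw [← R.tr_mul_res, one_mul, ← R.tr_comp, indLift_comp_indUnit]

end TambaraFunctor

namespace TambaraIdeal

open FinGSet

section
variable {G : Type u} [Group G] [Finite G] {R : TambaraFunctor.{u, v} G}

/-! ### Values of Tambara ideals at finite `G`-sets -/

theorem mem_value {I : TambaraIdeal R} {X : FinGSet G} {a : R.obj X} :
    a ∈ I.value X ↔ ∀ (L : Subgroup G) (f : orbit L →[G] X), R.res f a ∈ I.level L := by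
  simp only [value, Submodule.mem_iInf, Ideal.mem_comap]

theorem value_orbit (I : TambaraIdeal R) (K : Subgroup G) : I.value (orbit K) = I.level K := by
  ext a
  rw [mem_value]
  refine ⟨fun h => ?_, fun h L f => I.res_mem f h⟩
  rw [← R.res_id _ a]
  exact h K _

theorem value_mono {I J : TambaraIdeal R} (h : I ≤ J) (X : FinGSet G) : I.value X ≤ J.value X :=
  fun _ ha => mem_value.mpr fun L f => h L (mem_value.mp ha L f)

theorem res_mem_value (I : TambaraIdeal R) {X Y : FinGSet G} (f : X →[G] Y) {a : R.obj Y}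
    (ha : a ∈ I.value Y) : R.res f a ∈ I.value X :=
  mem_value.mpr fun L g => by
    rw [← R.res_comp]
    exact mem_value.mp ha L _

theorem tr_mem_value (I : TambaraIdeal R) {X Y : FinGSet G} (f : X →[G] Y) {a : R.obj X}
    (ha : a ∈ I.value X) : R.tr f a ∈ I.value Y :=
  mem_value.mpr fun L g => by
    rw [R.res_tr _ _ _ _ (isPullback_fiberProd f g)]
    refine R.mem_of_forall_tr_res_mem
      ((I.level L).toAddSubmonoid.comap (R.tr (snd f g))) fun M k => ?_
    rw [AddSubmonoid.mem_comap, ← R.tr_comp]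
    exact I.tr_mem _ (mem_value.mp (I.res_mem_value _ ha) M k)

/-- A pitfall: the norm along a map from the empty `G`-set to an orbit sends `0` to `1`. -/
theorem nm_mem_value (I : TambaraIdeal R) {X Y : FinGSet G} {f : X →[G] Y}
    (hf : Function.Surjective f) {a : R.obj X} (ha : a ∈ I.value X) : R.nm f a ∈ I.value Y :=
  mem_value.mpr fun L g => by
    have := ((isPullback_fiberProd f g).surjective hf).nonempty
    obtain ⟨K, Y, i, j, hij⟩ := exists_isCoproduct_orbit (fiberProd f g)
    rw [R.res_nm _ _ _ _ (isPullback_fiberProd f g),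
      ← R.nm_res_mul_nm_res hij (R.res (fst f g) a), map_mul, ← R.nm_comp]
    exact Ideal.mul_mem_right _ _ (I.nm_mem _ (mem_value.mp (I.res_mem_value _ ha) K i))

theorem subset_span (s : ∀ K : Subgroup G, Set (R.obj (orbit K))) (K : Subgroup G) :
    s K ⊆ (span s).level K := fun a ha => by
  change a ∈ (⨅ I ∈ _, TambaraIdeal.level I K : Ideal _)
  simp only [Submodule.mem_iInf]
  exact fun I hI => hI K ha

theorem span_le {s : ∀ K : Subgroup G, Set (R.obj (orbit K))} {I : TambaraIdeal R} :
    span s ≤ I ↔ ∀ K, s K ⊆ I.level K :=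
  ⟨fun h K => (subset_span s K).trans (h K), fun h _ => iInf₂_le_of_le I h le_rfl⟩

theorem mul_mem_mul {I J : TambaraIdeal R} {K : Subgroup G} {a b : R.obj (orbit K)}
    (ha : a ∈ I.level K) (hb : b ∈ J.level K) : a * b ∈ (I * J).level K :=
  subset_span _ K ⟨a, ha, b, hb, rfl⟩

theorem mul_le {I J P : TambaraIdeal R} : I * J ≤ P ↔
    ∀ K, ∀ a ∈ I.level K, ∀ b ∈ J.level K, a * b ∈ P.level K := by
  refine ⟨fun h K a ha b hb => h K (mul_mem_mul ha hb), fun h => span_le.mpr fun K => ?_⟩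
  rintro _ ⟨a, ha, b, hb, rfl⟩
  exact h K a ha b hb

theorem mul_mem_value_mul {I J : TambaraIdeal R} {X : FinGSet G} {a b : R.obj X}
    (ha : a ∈ I.value X) (hb : b ∈ J.value X) : a * b ∈ (I * J).value X :=
  mem_value.mpr fun L f => by
    rw [map_mul]
    exact mul_mem_mul (mem_value.mp ha L f) (mem_value.mp hb L f)

/-- The unit ideal. -/
instance : OrderTop (TambaraIdeal R) where
  top :=
    { level := fun _ => ⊤
      res_mem := fun _ _ _ => trivial
      tr_mem := fun _ _ _ => trivial
      nm_mem := fun _ _ _ => trivial }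
  le_top _ _ := le_top

theorem ne_top_iff {I : TambaraIdeal R} : I ≠ ⊤ ↔ ∃ K, I.level K ≠ ⊤ := by
  rw [Ne, TambaraIdeal.ext_iff, funext_iff, not_forall]
  rfl

theorem isPrime_iff {P : TambaraIdeal R} :
    P.IsPrime ↔ P ≠ ⊤ ∧ ∀ I J : TambaraIdeal R, I * J ≤ P → I ≤ P ∨ J ≤ P := by
  rw [IsPrime, ne_top_iff]

theorem isPrime_apply_iff {G' : Type*} [Group G'] [Finite G'] {S : TambaraFunctor G'}
    (e : TambaraIdeal R ≃*o TambaraIdeal S) {P : TambaraIdeal R} :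
    (e P).IsPrime ↔ P.IsPrime := by
  simp only [isPrime_iff, ne_eq, map_eq_top_iff, (EquivLike.surjective e).forall,
    ← map_mul, map_le_map_iff]

end

section
variable {G : Type u} [Group G] [Finite G] {R S : TambaraFunctor.{u, v} G}

/-! ### Extension and contraction along a morphism -/

theorem value_comap (φ : R.Hom S) (J : TambaraIdeal S) (X : FinGSet G) :
    (J.comap φ).value X = (J.value X).comap (φ.app X) := by
  ext a
  rw [Ideal.mem_comap, mem_value, mem_value]
  refine forall₂_congr fun L f => ?_
  rw [← φ.app_res]
  rfl

/-- The value at `X` of the Tambara ideal generated by `φ(I)`. -/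
def mapValue (φ : R.Hom S) (I : TambaraIdeal R) (X : FinGSet G) : Ideal (S.obj X) where
  carrier := {b | ∃ (Y : FinGSet G) (u : Y →[G] X) (c : S.obj Y), ∃ x ∈ I.value Y,
    S.tr u (c * φ.app Y x) = b}
  zero_mem' := ⟨X, MulActionHom.id G, 0, 0, Ideal.zero_mem _, by rw [zero_mul, map_zero]⟩
  add_mem' := by
    rintro _ _ ⟨Y, u, c, x, hx, rfl⟩ ⟨Z, w, d, y, hy, rfl⟩
    refine ⟨sum Y Z, desc u w, S.pair c d, R.pair x y,
      Ideal.add_mem _ (I.tr_mem_value _ hx) (I.tr_mem_value _ hy), ?_⟩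
    rw [φ.app_pair, S.pair_mul_pair, S.tr_desc_pair]
  smul_mem' := by
    rintro d _ ⟨Y, u, c, x, hx, rfl⟩
    refine ⟨Y, u, S.res u d * c, x, hx, ?_⟩
    rw [smul_eq_mul, mul_comm d, ← S.tr_mul_res, mul_assoc, mul_comm]

theorem tr_mul_app_mem_mapValue {φ : R.Hom S} {I : TambaraIdeal R} {X Y : FinGSet G}
    (u : Y →[G] X) (c : S.obj Y) {x : R.obj Y} (hx : x ∈ I.value Y) :
    S.tr u (c * φ.app Y x) ∈ mapValue φ I X :=
  ⟨Y, u, c, x, hx, rfl⟩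

theorem res_mem_mapValue {φ : R.Hom S} {I : TambaraIdeal R} {X Y : FinGSet G} (f : X →[G] Y)
    {b : S.obj Y} (hb : b ∈ mapValue φ I Y) : S.res f b ∈ mapValue φ I X := by
  obtain ⟨Z, u, c, x, hx, rfl⟩ := hb
  rw [S.res_tr _ _ _ _ (isPullback_fiberProd u f), map_mul, ← φ.app_res]
  exact tr_mul_app_mem_mapValue _ _ (I.res_mem_value _ hx)

theorem tr_mem_mapValue {φ : R.Hom S} {I : TambaraIdeal R} {X Y : FinGSet G} (f : X →[G] Y)
    {b : S.obj X} (hb : b ∈ mapValue φ I X) : S.tr f b ∈ mapValue φ I Y := by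
  obtain ⟨Z, u, c, x, hx, rfl⟩ := hb
  rw [← S.tr_comp]
  exact tr_mul_app_mem_mapValue _ _ hx

theorem nm_mem_mapValue {φ : R.Hom S} {I : TambaraIdeal R} {X Y : FinGSet G} {f : X →[G] Y}
    (hf : Function.Surjective f) {b : S.obj X} (hb : b ∈ mapValue φ I X) :
    S.nm f b ∈ mapValue φ I Y := by
  obtain ⟨Z, u, c, x, hx, rfl⟩ := hb
  have surjective_evalProj := (isPullback_eval f u).surjective hf
  rw [S.nm_tr _ _ _ _ _ (isExponential_depProd f u), map_mul, map_mul, ← φ.app_res, ← φ.app_nm]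
  exact tr_mul_app_mem_mapValue _ _ (I.nm_mem_value surjective_evalProj (I.res_mem_value _ hx))

/-- The Tambara ideal generated by the image of a Tambara ideal under a morphism. -/
def map (φ : R.Hom S) (I : TambaraIdeal R) : TambaraIdeal S where
  level K := mapValue φ I (orbit K)
  res_mem := res_mem_mapValue
  tr_mem := tr_mem_mapValue
  nm_mem f _ := nm_mem_mapValue (surjective_of_isPretransitive f)

theorem map_le_iff_le_comap {φ : R.Hom S} {I : TambaraIdeal R} {J : TambaraIdeal S} :
    map φ I ≤ J ↔ I ≤ J.comap φ := by
  constructor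
  · intro h K a ha
    rw [← value_orbit] at ha
    have app_mem := tr_mul_app_mem_mapValue (φ := φ) (MulActionHom.id G) 1 ha
    rw [one_mul, S.tr_id] at app_mem
    exact h K app_mem
  · rintro h K _ ⟨Y, u, c, x, hx, rfl⟩
    have app_mem : φ.app Y x ∈ J.value Y := (value_comap φ J Y).le (value_mono h Y hx)
    rw [← value_orbit]
    exact J.tr_mem_value u (Ideal.mul_mem_left _ c app_mem)

theorem map_mul_map_le (φ : R.Hom S) (I J : TambaraIdeal R) :
    map φ I * map φ J ≤ map φ (I * J) := by
  refine mul_le.mpr ?_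
  rintro K _ ⟨Y, u, c, x, hx, rfl⟩ _ ⟨Z, w, d, y, hy, rfl⟩
  rw [S.tr_mul_tr, map_mul (S.res _), map_mul (S.res _), mul_mul_mul_comm, ← φ.app_res,
    ← φ.app_res, ← map_mul (φ.app _)]
  exact tr_mul_app_mem_mapValue _ _
    (mul_mem_value_mul (I.res_mem_value _ hx) (J.res_mem_value _ hy))

theorem IsPrime.comap {P : TambaraIdeal S} (hP : P.IsPrime) (φ : R.Hom S) :
    (P.comap φ).IsPrime := by
  obtain ⟨⟨K, hK⟩, mul_le_imp⟩ := hP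
  refine ⟨⟨K, Ideal.comap_ne_top _ hK⟩, fun I J h => ?_⟩
  have map_mul_le : map φ I * map φ J ≤ P :=
    (map_mul_map_le φ I J).trans (map_le_iff_le_comap.mpr h)
  exact (mul_le_imp _ _ map_mul_le).imp map_le_iff_le_comap.mp map_le_iff_le_comap.mp

end

section
variable {G : Type u} [Group G] [Finite G] {H : Subgroup G} {R : TambaraFunctor.{u, v} H}

/-! ### Coinduction of Tambara ideals -/

/-- The coinduction of a Tambara ideal: its value at `X` is the value at the underlying `H`-set. -/
def coind (I : TambaraIdeal R) : TambaraIdeal (R.coind H) where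
  level K := I.coindLevel H K
  res_mem f _ := I.res_mem_value (restrictMap H f)
  tr_mem f _ := I.tr_mem_value (restrictMap H f)
  nm_mem f _ := I.nm_mem_value (f := restrictMap H f) (surjective_of_isPretransitive f)

theorem res_indUnit_surjective (R : TambaraFunctor.{u, v} H) (L : Subgroup H) :
    Function.Surjective (R.res (indUnit H L)) :=
  fun a => ⟨R.tr (indUnit H L) a, R.res_tr_of_injective (indUnit_injective L) a⟩

/-- The Tambara ideal of `R` whose coinduction is a given Tambara ideal of `R.coind H`. Its level at
`H/L` is the projection of the level at `G/L` to the factor `R(H/L)` of `R((G/L)|_H)`. -/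
def descend (J : TambaraIdeal (R.coind H)) : TambaraIdeal R where
  level L := Ideal.map (R.res (indUnit H L)) (J.level (L.map H.subtype))
  res_mem {K L} f a ha := by
    obtain ⟨b, hb, rfl⟩ := (Ideal.mem_map_iff_of_surjective _ (res_indUnit_surjective R L)).mp ha
    rw [← R.res_comp, ← indMap_comp_indUnit, R.res_comp]
    exact Ideal.mem_map_of_mem _ (J.res_mem (indMap f) hb)
  tr_mem {K L} f a ha := by
    obtain ⟨b, hb, rfl⟩ := (Ideal.mem_map_iff_of_surjective _ (res_indUnit_surjective R K)).mp ha
    rw [← R.res_tr _ _ _ _ (isPullback_indMap f)]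
    exact Ideal.mem_map_of_mem _ (J.tr_mem (indMap f) hb)
  nm_mem {K L} f a ha := by
    obtain ⟨b, hb, rfl⟩ := (Ideal.mem_map_iff_of_surjective _ (res_indUnit_surjective R K)).mp ha
    rw [← R.res_nm _ _ _ _ (isPullback_indMap f)]
    exact Ideal.mem_map_of_mem _ (J.nm_mem (indMap f) hb)

theorem mem_descend {J : TambaraIdeal (R.coind H)} {L : Subgroup H} {a : R.obj (orbit L)} :
    a ∈ J.descend.level L ↔ ∃ b ∈ J.level (L.map H.subtype), R.res (indUnit H L) b = a :=
  Ideal.mem_map_iff_of_surjective _ (res_indUnit_surjective R L)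

theorem tr_indUnit_mem_coind {I : TambaraIdeal R} {L : Subgroup H} {a : R.obj (orbit L)}
    (ha : a ∈ I.level L) : R.tr (indUnit H L) a ∈ (coind I).level (L.map H.subtype) :=
  I.tr_mem_value _ ((I.value_orbit L).ge ha)

theorem descend_coind (I : TambaraIdeal R) : (coind (H := H) I).descend = I := by
  ext L a
  rw [mem_descend]
  constructor
  · rintro ⟨b, hb, rfl⟩
    exact mem_value.mp hb L (indUnit H L)
  · exact fun ha => ⟨_, tr_indUnit_mem_coind ha, R.res_tr_of_injective (indUnit_injective L) a⟩

theorem tr_res_mem_of_mem_descend {J : TambaraIdeal (R.coind H)} {K : Subgroup G} {L : Subgroup H}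
    (f : orbit L →[H] (orbit K).restrict H) {a : R.obj (orbit L)} (ha : a ∈ J.descend.level L) :
    R.tr f a ∈ J.level K := by
  obtain ⟨b, hb, rfl⟩ := mem_descend.mp ha
  exact (congrArg (· ∈ J.level K) (R.tr_res_indUnit f b)).mpr
    (J.tr_mem (indLift f) (Ideal.mul_mem_left (J.level _) _ hb))

theorem res_mem_descend {J : TambaraIdeal (R.coind H)} {K : Subgroup G} {L : Subgroup H}
    (f : orbit L →[H] (orbit K).restrict H) {a : R.obj ((orbit K).restrict H)}
    (ha : a ∈ J.level K) : R.res f a ∈ J.descend.level L := by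
  rw [← indLift_comp_indUnit f, R.res_comp]
  exact mem_descend.mpr ⟨_, J.res_mem (indLift f) ha, rfl⟩

theorem coind_descend (J : TambaraIdeal (R.coind H)) : coind J.descend = J := by
  ext K a
  refine mem_value.trans ⟨fun h => ?_, fun ha L f => res_mem_descend f ha⟩
  exact R.mem_of_forall_tr_res_mem (J.level K).toAddSubmonoid
    fun L f => tr_res_mem_of_mem_descend f (h L f)

theorem coind_mono : Monotone (coind (H := H) (R := R)) :=
  fun _ _ h _ => value_mono h _

theorem descend_mono : Monotone (descend (H := H) (R := R)) :=
  fun _ _ h _ => Ideal.map_mono (h _)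

theorem coind_le_coind_iff {I J : TambaraIdeal R} : coind (H := H) I ≤ coind J ↔ I ≤ J :=
  ⟨fun h => by simpa only [descend_coind] using descend_mono h, fun h => coind_mono h⟩

theorem coind_mul (I J : TambaraIdeal R) : coind (H := H) (I * J) = coind I * coind J := by
  refine le_antisymm ?_ (mul_le.mpr fun K a ha b hb => mul_mem_value_mul ha hb)
  rw [← coind_descend (coind I * coind J), coind_le_coind_iff]
  refine mul_le.mpr fun L a ha b hb => mem_descend.mpr
    ⟨_, mul_mem_mul (tr_indUnit_mem_coind ha) (tr_indUnit_mem_coind hb), ?_⟩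
  exact (map_mul (R.res (indUnit H L)) _ _).trans (congrArg₂ (· * ·)
    (R.res_tr_of_injective (indUnit_injective L) a) (R.res_tr_of_injective (indUnit_injective L) b))

/-- Coinduction as an isomorphism of partially ordered sets with multiplication. -/
noncomputable def coindIso (R : TambaraFunctor.{u, v} H) :
    TambaraIdeal R ≃*o TambaraIdeal (R.coind H) where
  toFun := coind
  invFun := descend
  left_inv := descend_coind
  right_inv := coind_descend
  map_mul' := coind_mul
  map_le_map_iff' := coind_le_coind_iff

theorem comap_coind {S : TambaraFunctor.{u, v} H} (φ : R.Hom S) (J : TambaraIdeal S) :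
    (coind J).comap (φ.coind H) = coind (J.comap φ) :=
  TambaraIdeal.ext (funext fun K => (value_comap φ J ((orbit K).restrict H)).symm)

end

end TambaraIdeal

namespace NakaokaSpectrum

section
variable {G : Type u} [Group G] [Finite G] {R : TambaraFunctor.{u, v} G}

theorem continuous_iff {X : Type*} [TopologicalSpace X] {f : X → NakaokaSpectrum R} :
    Continuous f ↔ ∀ I, IsClosed (f ⁻¹' zeroLocus I) := by
  refine continuous_generateFrom_iff.trans ⟨fun h I => ⟨h _ ⟨I, rfl⟩⟩, ?_⟩
  rintro h _ ⟨I, rfl⟩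
  exact (h I).isOpen_compl

theorem isClosed_zeroLocus (I : TambaraIdeal R) : IsClosed (zeroLocus I) :=
  ⟨TopologicalSpace.isOpen_generateFrom_of_mem ⟨I, rfl⟩⟩

/-- The continuous map of spectra induced by a morphism of Tambara functors. -/
def comap {S : TambaraFunctor.{u, v} G} (φ : R.Hom S) :
    C(NakaokaSpectrum S, NakaokaSpectrum R) where
  toFun p := ⟨p.ideal.comap φ, p.2.comap φ⟩
  continuous_toFun := continuous_iff.mpr fun I => by
    convert isClosed_zeroLocus (I.map φ) using 1
    exact Set.ext fun p => TambaraIdeal.map_le_iff_le_comap.symm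

section
variable {G' : Type*} [Group G'] [Finite G'] {S : TambaraFunctor G'}

/-- The map of spectra induced by an isomorphism of partially ordered sets with multiplication
between the sets of Tambara ideals. -/
def mapIso (e : TambaraIdeal R ≃*o TambaraIdeal S) (p : NakaokaSpectrum R) : NakaokaSpectrum S :=
  ⟨e p.ideal, (TambaraIdeal.isPrime_apply_iff e).mpr p.2⟩

theorem continuous_mapIso (e : TambaraIdeal R ≃*o TambaraIdeal S) : Continuous (mapIso e) :=
  continuous_iff.mpr fun I => by
    convert isClosed_zeroLocus (e.symm I) using 1
    exact Set.ext fun p => (e : TambaraIdeal R ≃o TambaraIdeal S).symm_apply_le.symm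

/-- The homeomorphism of spectra induced by an isomorphism of partially ordered sets with
multiplication between the sets of Tambara ideals. -/
def homeomorphOfIso (e : TambaraIdeal R ≃*o TambaraIdeal S) :
    NakaokaSpectrum R ≃ₜ NakaokaSpectrum S where
  toFun := mapIso e
  invFun := mapIso e.symm
  left_inv p := Subtype.ext (e.symm_apply_apply p.ideal)
  right_inv p := Subtype.ext (e.apply_symm_apply p.ideal)
  continuous_toFun := continuous_mapIso e
  continuous_invFun := continuous_mapIso e.symm

end

end

section
variable {G : Type u} [Group G] [Finite G] {H : Subgroup G}

/-- The homeomorphism of the spectra of a Tambara functor and its coinduction. -/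
noncomputable def coindHomeomorph (R : TambaraFunctor.{u, v} H) :
    NakaokaSpectrum R ≃ₜ NakaokaSpectrum (R.coind H) :=
  homeomorphOfIso (TambaraIdeal.coindIso R)

theorem coindHomeomorph_comap {R S : TambaraFunctor.{u, v} H} (φ : R.Hom S)
    (p : NakaokaSpectrum S) :
    coindHomeomorph R (comap φ p) = comap (φ.coind H) (coindHomeomorph S p) :=
  Subtype.ext (TambaraIdeal.comap_coind φ p.ideal).symm

theorem coindHomeomorph_symm_comap {R S : TambaraFunctor.{u, v} H} (φ : R.Hom S)
    (q : NakaokaSpectrum (S.coind H)) :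
    (coindHomeomorph R).symm (comap (φ.coind H) q) = comap φ ((coindHomeomorph S).symm q) := by
  rw [Homeomorph.symm_apply_eq, coindHomeomorph_comap, Homeomorph.apply_symm_apply]

end

end NakaokaSpectrum

theorem mainTheorem1 {G : Type u} [Group G] [Finite G] (H : Subgroup G) :
    ∃ (Φ : ∀ R : TambaraFunctor.{u, v} H, TambaraIdeal R ≃o TambaraIdeal (R.coind H))
      (Ψ : ∀ R : TambaraFunctor.{u, v} H, NakaokaSpectrum (R.coind H) ≃ₜ NakaokaSpectrum R),
      -- the bijection is coinduction of ideals
      (∀ (R : TambaraFunctor.{u, v} H) (I : TambaraIdeal R) (K : Subgroup G),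
        (Φ R I).level K = I.coindLevel H K) ∧
      -- it respects products and primality
      (∀ (R : TambaraFunctor.{u, v} H) (I J : TambaraIdeal R), Φ R (I * J) = Φ R I * Φ R J) ∧
      (∀ (R : TambaraFunctor.{u, v} H) (p : TambaraIdeal R), (Φ R p).IsPrime ↔ p.IsPrime) ∧
      -- the homeomorphism is the inverse of the bijection on prime ideals
      (∀ (R : TambaraFunctor.{u, v} H) (p : NakaokaSpectrum (R.coind H)),
        Φ R (Ψ R p).ideal = p.ideal) ∧
      -- contraction of prime ideals along a morphism of `H`-Tambara functors and along its
      -- coinduction gives continuous maps of spectra, and the homeomorphism is natural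
      (∀ (R S : TambaraFunctor.{u, v} H) (φ : R.Hom S),
        ∃ (s : C(NakaokaSpectrum S, NakaokaSpectrum R))
          (t : C(NakaokaSpectrum (S.coind H), NakaokaSpectrum (R.coind H))),
          (∀ q, (s q).ideal = q.ideal.comap φ) ∧
          (∀ q, (t q).ideal = q.ideal.comap (φ.coind H)) ∧
          ∀ q, Ψ R (t q) = s (Ψ S q)) := by
  refine ⟨fun R => (TambaraIdeal.coindIso R : TambaraIdeal R ≃o TambaraIdeal (R.coind H)),
    fun R => (NakaokaSpectrum.coindHomeomorph R).symm, fun _ _ _ => rfl,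
    fun R => map_mul (TambaraIdeal.coindIso R),
    fun R _ => TambaraIdeal.isPrime_apply_iff (TambaraIdeal.coindIso R),
    fun R p => congrArg NakaokaSpectrum.ideal
      ((NakaokaSpectrum.coindHomeomorph R).apply_symm_apply p),
    fun R S φ => ?_⟩
  exact ⟨NakaokaSpectrum.comap φ, NakaokaSpectrum.comap (φ.coind H), fun _ => rfl, fun _ => rfl,
    NakaokaSpectrum.coindHomeomorph_symm_comap φ⟩
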